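/- Let $K$ be an algebraic number field that is Galois over $\mathbb{Q}$, with ring of integers $\mathcal{O}$. For a nonzero prime ideal $\mathfrak{p}$ of $\mathcal{O}$ let $\mathcal{O}_\mathfrak{p}$ be the ring of $\mathfrak{p}$-adic integers (the ring of integers of the completion of $K$ at $\mathfrak{p}$) and, if $\mathfrak{p}$ is unramified over the prime number $p$, let $\mathrm{Frob}_\mathfrak{p}$ be the Frobenius element, i.e. the unique element of the decomposition group of $\mathfrak{p}$ in $\mathrm{Gal}(K/\mathbb{Q})$ with $\mathrm{Frob}_\mathfrak{p}(x)\equiv x^p \bmod \mathfrak{p}$ for all $x\in\mathcal{O}$. A prime number $p$ is called unramified in $K|\mathbb{Q}$ if all prime ideals of $\mathcal{O}$ dividing $p$ are unramified. Let $\mathcal{S}^1(K|\mathbb{Q})$ be the set of power series $V=\sum_{n\ge 1}a_nz^n\in zK[[z]]$ whose coefficients form a $1$-sequence: for every prime $p$ unramified in $K|\mathbb{Q}$ and every prime ideal $\mathfrak{p}\mid p$ one has $a_n\in\mathcal{O}_\mathfrak{p}$ for all $n\ge 1$ and $$\mathrm{Frob}_\mathfrak{p}\left(a_{mp^{r-1}}\right)\equiv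 a_{mp^r} \mod p^{r}\mathcal{O}_\mathfrak{p}\qquad\text{for all integers } m,r\ge 1 .$$ Let $V=\sum_{n\ge1}a_nz^n\in\mathcal{S}^1(K|\mathbb{Q})$, let $\smallint V=\sum_{n\ge 1}\frac{a_n}{n}z^n$ and $Y=\exp(\smallint V)\in 1+zK[[z]]$, let $p$ be a prime number unramified in $K|\mathbb{Q}$ and let $\mathfrak{p}\subset\mathcal{O}$ be a prime ideal dividing $p$. Then for all integers $n,m\ge 1$ the $m$-th coefficient of $Y(z)^n$ satisfies $$\left[Y(z)^n\right]_m\equiv 0 \mod p^{\max\{0,\ \mathrm{ord}_p(n)-\mathrm{ord}_p(m)\}}\mathcal{O}_\mathfrak{p}.$$ -/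

import Mathlib

open scoped NumberField PowerSeries

open IsDedekindDomain in
/-- For a nonzero prime ideal `𝔭` (the place `v`) of the ring of integers of the number field `K`,
an integer `p` and `x, y ∈ K`: the congruence `x ≡ y mod p ^ k 𝒪_𝔭`, where
`𝒪_𝔭 = v.adicCompletionIntegers K` is the ring of `𝔭`-adic integers, i.e. the ring of integers of
the completion `K_𝔭 = v.adicCompletion K`. -/
def CongrModPow (K : Type*) [Field K] [NumberField K] (v : HeightOneSpectrum (𝓞 K))
    (p k : ℕ) (x y : K) : Prop :=
  ∃ c ∈ v.adicCompletionIntegers K,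
    algebraMap K (v.adicCompletion K) (x - y) = (p : v.adicCompletion K) ^ k * c

/-- The prime number `p` is unramified in `K | ℚ`: all prime ideals of `𝓞 K` above `p` are
unramified over `ℤ`. -/
def IsUnramifiedPrime (K : Type*) [Field K] [NumberField K] (p : ℕ) : Prop :=
  p.Prime ∧ Algebra.IsUnramifiedIn (𝓞 K) (Ideal.span {(p : ℤ)})

open IsDedekindDomain in
/-- The Frobenius element of `K | ℚ` at `𝔭`: an element `φ` of `Gal(K | ℚ)` (of the decomposition
group of `𝔭`) with `φ x ≡ x ^ p mod 𝔭` for all `x ∈ 𝓞 K`; it is unique when `𝔭` is unramified. -/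
noncomputable def frobeniusAt (K : Type*) [Field K] [NumberField K] [IsGalois ℚ K]
    (v : HeightOneSpectrum (𝓞 K)) : K ≃ₐ[ℚ] K :=
  haveI : Finite (𝓞 K ⧸ v.asIdeal) := Ideal.finiteQuotientOfFreeOfNeBot v.asIdeal v.ne_bot
  arithFrobAt ℤ (K ≃ₐ[ℚ] K) v.asIdeal

open IsDedekindDomain in
/-- The sequence `(a n)_{n ≥ 1}` (the value `a 0` plays no role) satisfies the local `s`-function
property at the prime `p`. -/
def LocalSFunctionProperty (K : Type*) [Field K] [NumberField K] [IsGalois ℚ K]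
    (s p : ℕ) (a : ℕ → K) : Prop :=
  ∀ v : HeightOneSpectrum (𝓞 K), (p : 𝓞 K) ∈ v.asIdeal →
    (∀ n, 0 < n → algebraMap K (v.adicCompletion K) (a n) ∈ v.adicCompletionIntegers K) ∧
    ∀ m r, 0 < m → 0 < r →
      CongrModPow K v p (s * r) (frobeniusAt K v (a (m * p ^ (r - 1)))) (a (m * p ^ r))

/-- `(a n)_{n ≥ 1}` is an `s`-sequence with coefficients in `K`. -/
def IsSSequence (K : Type*) [Field K] [NumberField K] [IsGalois ℚ K]
    (s : ℕ) (a : ℕ → K) : Prop :=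
  ∀ p : ℕ, IsUnramifiedPrime K p → LocalSFunctionProperty K s p a

/-- The set `𝒮^s(K | ℚ) ⊆ z K⟦z⟧` of generating functions `∑_{n ≥ 1} a n z ^ n` of
`s`-sequences. -/
def SSeries (K : Type*) [Field K] [NumberField K] [IsGalois ℚ K] (s : ℕ) : Set K⟦X⟧ :=
  {V | PowerSeries.constantCoeff V = 0 ∧ IsSSequence K s (fun n => PowerSeries.coeff n V)}

/-- Logarithmic integration `∑_{n ≥ 1} a n z ^ n ↦ ∑_{n ≥ 1} (a n / n) z ^ n`
(the constant term of the result is `0`). -/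
noncomputable def logIntegral {K : Type*} [Field K] (V : K⟦X⟧) : K⟦X⟧ :=
  PowerSeries.mk fun n => PowerSeries.coeff n V / (n : K)

/-- The power series `exp (∫ V)`, with `∫` the logarithmic integration. -/
noncomputable def expLogIntegral {K : Type*} [Field K] [CharZero K] (V : K⟦X⟧) : K⟦X⟧ :=
  (PowerSeries.exp K).subst (logIntegral V)

namespace PowerSeries

/-! Work in the valuation ring `A` of `v` in `K`, with `σ` the Frobenius. The `1`-sequence
congruences say that `F = (∫V)^σ(z^p) - p ∫V` has all coefficients in `pA`. As `p^d / d!` lies in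
`pA` for `d ≥ 1`, `exp F ≡ 1` mod `p`, while `Y^σ(z^p) = Y^p exp F`. Dwork's lemma
(`coeff_mem_of_expand_map_eq`) then makes `Y` integral.

Finally `z (Y^n)' = n V Y^n` gives `m [Y^n]_m = n [V Y^n]_m` with `[V Y^n]_m` in `A`; dividing by
`m` costs at most `ord_p m` factors of `p`. -/

theorem constantCoeff_map_eq_zero {K : Type*} [Field K] {f : K⟦X⟧} (hf : constantCoeff f = 0)
    (σ : K →+* K) : constantCoeff (map σ f) = 0 := by
  rw [← coeff_zero_eq_constantCoeff_apply] at hf ⊢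
  rw [coeff_map, hf, map_zero]

/-! ### Functional equations of `exp`, from uniqueness of solutions of `f' = h f`. -/

section ExpSubst

variable {K : Type*} [Field K] [CharZero K]

/-- A power series over a field of characteristic zero is determined by its constant coefficient
and its logarithmic derivative. -/
theorem eq_of_derivative_eq_mul {f g h : K⟦X⟧} (hf : d⁄dX K f = h * f) (hg : d⁄dX K g = h * g)
    (h0 : constantCoeff f = constantCoeff g) : f = g := by
  ext n
  induction n using Nat.strong_induction_on with
  | _ n ih =>
    cases n with
    | zero => simpa using h0
    | succ n =>
      have hf' := congrArg (coeff n) hf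
      have hg' := congrArg (coeff n) hg
      rw [coeff_derivative, coeff_mul] at hf' hg'
      refine mul_right_cancel₀ (Nat.cast_add_one_ne_zero n : ((n : K) + 1) ≠ 0) ?_
      rw [hf', hg']
      refine Finset.sum_congr rfl fun x hx ↦ ?_
      rw [ih x.2 (by have := Finset.HasAntidiagonal.mem_antidiagonal.1 hx; lia)]

theorem derivative_exp_subst {f : K⟦X⟧} (hf : constantCoeff f = 0) :
    d⁄dX K ((exp K).subst f) = d⁄dX K f * (exp K).subst f := by
  rw [derivative_subst (HasSubst.of_constantCoeff_zero' hf), derivative_exp, mul_comm]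

theorem constantCoeff_exp_subst {f : K⟦X⟧} (hf : constantCoeff f = 0) :
    constantCoeff ((exp K).subst f) = 1 := by
  rw [← coeff_zero_eq_constantCoeff_apply, coeff_subst' (HasSubst.of_constantCoeff_zero' hf),
    finsum_eq_single _ 0]
  · simp
  · intro d hd
    simp [hf, hd]

theorem exp_subst_add {f g : K⟦X⟧} (hf : constantCoeff f = 0) (hg : constantCoeff g = 0) :
    (exp K).subst (f + g) = (exp K).subst f * (exp K).subst g := by
  have hfg : constantCoeff (f + g) = 0 := by simp [hf, hg]
  refine eq_of_derivative_eq_mul (derivative_exp_subst hfg) ?_ ?_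
  · rw [Derivation.leibniz, derivative_exp_subst hf, derivative_exp_subst hg, map_add]
    simp only [smul_eq_mul]
    ring
  · rw [map_mul, constantCoeff_exp_subst hf, constantCoeff_exp_subst hg,
      constantCoeff_exp_subst hfg, one_mul]

theorem exp_subst_natCast_mul {f : K⟦X⟧} (hf : constantCoeff f = 0) (n : ℕ) :
    (exp K).subst ((n : K⟦X⟧) * f) = (exp K).subst f ^ n := by
  have hnf : constantCoeff ((n : K⟦X⟧) * f) = 0 := by simp [hf]
  refine eq_of_derivative_eq_mul (derivative_exp_subst hnf) ?_ ?_
  · rw [derivative_pow, derivative_exp_subst hf, Derivation.leibniz, Derivation.map_natCast]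
    cases n with
    | zero => simp
    | succ n =>
      simp only [smul_eq_mul, Nat.add_sub_cancel, pow_succ]
      ring
  · rw [map_pow, constantCoeff_exp_subst hf, constantCoeff_exp_subst hnf, one_pow]

theorem map_exp_subst {f : K⟦X⟧} (hf : constantCoeff f = 0) (σ : K →+* K) :
    map σ ((exp K).subst f) = (exp K).subst (map σ f) := by
  have := map_subst (HasSubst.of_constantCoeff_zero' hf) (h := σ) (exp K)
  rw [map_exp] at this
  exact this

theorem expand_exp_subst {f : K⟦X⟧} (hf : constantCoeff f = 0) {p : ℕ} (hp : p ≠ 0) :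
    expand p hp ((exp K).subst f) = (exp K).subst (expand p hp f) :=
  expand_subst p hp (HasSubst.of_constantCoeff_zero' hf) (exp K)

end ExpSubst

/-! ### Integrality over a subring: Dwork's lemma and `exp` of series divisible by `p`. -/

section Integrality

variable {K : Type*} [Field K]

theorem exists_map_subtype_eq (A : Subring K) {f : K⟦X⟧} (hf : ∀ n, coeff n f ∈ A) :
    ∃ g : A⟦X⟧, map A.subtype g = f :=
  ⟨mk fun n ↦ ⟨coeff n f, hf n⟩, by ext n; simp⟩

theorem coeff_map_subtype_mem (A : Subring K) (g : A⟦X⟧) (n : ℕ) :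
    coeff n (map A.subtype g) ∈ A := by
  simp

theorem coeff_mul_mem (A : Subring K) {f g : K⟦X⟧} (hf : ∀ n, coeff n f ∈ A)
    (hg : ∀ n, coeff n g ∈ A) (n : ℕ) : coeff n (f * g) ∈ A := by
  rw [coeff_mul]
  exact A.sum_mem fun x _ ↦ A.mul_mem (hf _) (hg _)

theorem coeff_pow_mem (A : Subring K) {f : K⟦X⟧} (hf : ∀ n, coeff n f ∈ A) (k n : ℕ) :
    coeff n (f ^ k) ∈ A := by
  obtain ⟨g, rfl⟩ := exists_map_subtype_eq A hf
  rw [← map_pow]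
  exact coeff_map_subtype_mem A _ n

variable {p : ℕ} [Fact p.Prime]

/-- In characteristic `p` modulo `p`: `f ^ p ≡ f^φ (z ^ p)`, with `φ` the `p`-th power map. -/
theorem exists_coeff_pow_prime_eq {R : Type*} [CommRing R] (hp : (p : R) ∈ nonunits R)
    (f : R⟦X⟧) (n : ℕ) :
    ∃ c, coeff n (f ^ p) = (if p ∣ n then coeff (n / p) f ^ p else 0) + p * c := by
  let I : Ideal R := Ideal.span {(p : R)}
  -- Since `p` is not a unit, the quotient is nontrivial and has characteristic exactly `p`.
  have : CharP (R ⧸ I) p := CharP.quotient R p hp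
  have : ExpChar (R ⧸ I) p := .prime Fact.out
  have hp0 : p ≠ 0 := (Fact.out : p.Prime).ne_zero
  have key : map (frobenius (R ⧸ I) p) (expand p hp0 (map (Ideal.Quotient.mk I) f)) =
      map (Ideal.Quotient.mk I) f ^ p := MvPowerSeries.map_frobenius_expand p hp0
  have hn := congrArg (coeff n) key
  rw [← map_pow, coeff_map, coeff_map, coeff_expand, coeff_map] at hn
  have : coeff n (f ^ p) - (if p ∣ n then coeff (n / p) f ^ p else 0) ∈ I := by
    rw [← Ideal.Quotient.eq, ← hn]
    split_ifs <;> simp [frobenius_def, hp0]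
  obtain ⟨c, hc⟩ := Ideal.mem_span_singleton'.1 this
  exact ⟨c, by rw [mul_comm, hc]; ring⟩

/-- **Dwork's lemma.** -/
theorem coeff_mem_of_expand_map_eq (A : Subring K) (hp : (p : K)⁻¹ ∉ A) (hp0 : (p : K) ≠ 0)
    (σ : K →+* K) (hσ : ∀ x ∈ A, ∃ c ∈ A, σ x - x ^ p = p * c) {Y G : K⟦X⟧}
    (hY : constantCoeff Y = 1) (hG : constantCoeff G = 1)
    (hG' : ∀ n, 0 < n → ∃ c ∈ A, coeff n G = p * c)
    (h : expand p (Fact.out : p.Prime).ne_zero (map σ Y) = Y ^ p * G) (n : ℕ) :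
    coeff n Y ∈ A := by
  have hpp : p.Prime := Fact.out
  induction n using Nat.strong_induction_on with
  | _ n ih =>
    rcases Nat.eq_zero_or_pos n with rfl | hn
    · simp [hY]
    -- `T` is the truncation of `Y` below degree `n`, integral by induction. Comparing coefficients
    -- of `z^n` in `h` will give `p * coeff n Y` as an element of `pA`.
    let T : A⟦X⟧ := mk fun i ↦ if h : i < n then ⟨coeff i Y, ih i h⟩ else 0
    have hT : ∀ i, i < n → ((coeff i T : A) : K) = coeff i Y := by
      intro i hi
      simp [T, hi]
    let Q : K⟦X⟧ := mk fun i ↦ coeff (i + n) Y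
    have hYT : Y = map A.subtype T + X ^ n * Q := by
      ext i
      by_cases hi : i < n
      · simp [hT i hi, coeff_X_pow_mul', hi.not_ge]
      · simp [T, Q, coeff_X_pow_mul', hi, not_lt.1 hi]
    obtain ⟨k, hk⟩ := Polynomial.powAddExpansion (map A.subtype T) (X ^ n * Q) p
    rw [← hYT] at hk
    have hYp : Y ^ p = map A.subtype (T ^ p) +
        X ^ n * ((p : K⟦X⟧) * map A.subtype T ^ (p - 1) * Q + X ^ n * (k * Q ^ 2)) := by
      rw [hk, map_pow]
      ring
    have hlow : ∀ i, i < n → coeff i (Y ^ p) ∈ A := by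
      intro i hi
      rw [hYp, map_add, coeff_X_pow_mul', if_neg hi.not_ge, add_zero]
      exact coeff_map_subtype_mem A _ i
    have hT0 : constantCoeff (map A.subtype T) = 1 := by
      rw [← coeff_zero_eq_constantCoeff_apply, coeff_map]
      simpa [hY] using hT 0 hn
    -- The unknown coefficient enters only linearly: `T` has constant term `1`, and the quadratic
    -- remainder starts in degree `2n > n`.
    have htop : coeff n (Y ^ p) = (coeff n (T ^ p) : A) + p * coeff n Y := by
      rw [hYp, map_add, coeff_map, coeff_X_pow_mul', if_pos le_rfl, Nat.sub_self,
        coeff_zero_eq_constantCoeff_apply]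
      have h0 : constantCoeff (X ^ n : K⟦X⟧) = 0 := by simp [hn.ne']
      simp only [map_add, map_mul, map_pow _ (map A.subtype T), hT0, h0]
      simp [Q]
    obtain ⟨c, hc⟩ := exists_coeff_pow_prime_eq (R := A) (p := p) (by
      rw [mem_nonunits_iff]
      intro hu
      obtain ⟨b, hb⟩ := hu.exists_right_inv
      refine hp ?_
      rw [← eq_inv_of_mul_eq_one_right (by simpa using congrArg A.subtype hb)]
      exact b.2) T n
    have hfrob : ∃ c ∈ A, coeff n (expand p hpp.ne_zero (map σ Y)) =
        ((if p ∣ n then coeff (n / p) T ^ p else 0 : A) : K) + p * c := by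
      rw [coeff_expand]
      split_ifs with hd
      · have hlt : n / p < n := Nat.div_lt_self hn hpp.one_lt
        obtain ⟨c, hcA, hc⟩ := hσ _ (ih _ hlt)
        refine ⟨c, hcA, ?_⟩
        rw [coeff_map, ← hc]
        simp [hT _ hlt]
      · exact ⟨0, A.zero_mem, by simp⟩
    obtain ⟨c', hc'A, hc'⟩ := hfrob
    -- Apart from `(n, 0)`, each term pairs a coefficient of `Y^p` of index below `n`, hence
    -- integral, with a positive-degree coefficient of `G`, hence in `pA`.
    have hrest : ∃ c ∈ A, coeff n (Y ^ p * G) = coeff n (Y ^ p) + p * c := by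
      rw [coeff_mul, Finset.sum_eq_add_sum_sdiff_singleton_of_mem
        (i := (n, 0)) (by simp)]
      choose! b hbA hb using hG'
      refine ⟨∑ x ∈ Finset.HasAntidiagonal.antidiagonal n \ {(n, 0)}, coeff x.1 (Y ^ p) * b x.2, ?_, ?_⟩
      · refine A.sum_mem fun x hx ↦ ?_
        have hx' : x.1 < n ∧ 0 < x.2 := by
          obtain ⟨i, j⟩ := x
          simp only [Finset.mem_sdiff, Finset.HasAntidiagonal.mem_antidiagonal, Finset.mem_singleton,
            Prod.mk.injEq] at hx
          lia
        exact A.mul_mem (hlow _ hx'.1) (hbA _ hx'.2)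
      · rw [Finset.mul_sum]
        congr 1
        · simp [hG]
        · refine Finset.sum_congr rfl fun x hx ↦ ?_
          have hx' : 0 < x.2 := by
            obtain ⟨i, j⟩ := x
            simp only [Finset.mem_sdiff, Finset.HasAntidiagonal.mem_antidiagonal, Finset.mem_singleton,
              Prod.mk.injEq] at hx
            lia
          rw [hb _ hx']
          ring
    obtain ⟨c'', hc''A, hc''⟩ := hrest
    rw [h, hc'', htop, hc] at hc'
    have : coeff n Y = c' - c'' - c := by
      refine mul_left_cancel₀ hp0 ?_
      push_cast at hc'
      linear_combination hc'
    rw [this]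
    exact A.sub_mem (A.sub_mem hc'A hc''A) c.2

variable [CharZero K]

/-- Legendre's bound `ord_p(d!) < d` for `d > 0` leaves at least one factor `p`, even when `p = 2`.
-/
theorem exists_pow_div_factorial_eq (A : Subring K)
    (hA : ∀ u : ℕ, u.Coprime p → (u : K)⁻¹ ∈ A) {d : ℕ} (hd : d ≠ 0) :
    ∃ c ∈ A, (p : K) ^ d / (d.factorial : K) = p * c := by
  have hpp : p.Prime := Fact.out
  have hpK : (p : K) ≠ 0 := Nat.cast_ne_zero.2 hpp.ne_zero
  obtain ⟨k, u, hu, hk⟩ := Nat.exists_eq_pow_mul_and_not_dvd d.factorial_ne_zero p hpp.ne_one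
  have hkd : k < d := by
    have hv : padicValNat p d.factorial = k := by
      rw [hk, padicValNat.mul (pow_ne_zero _ hpp.ne_zero) (by rintro rfl; simp at hu),
        padicValNat.prime_pow, padicValNat.eq_zero_of_not_dvd hu, add_zero]
    rw [← hv]
    exact padicValNat_factorial_lt_of_ne_zero p hd
  obtain ⟨e, rfl⟩ := Nat.exists_eq_add_of_lt hkd
  refine ⟨(p : K) ^ e * (u : K)⁻¹, A.mul_mem (A.pow_mem (natCast_mem A p) _)
    (hA u ((Nat.Prime.coprime_iff_not_dvd hpp).2 hu).symm), ?_⟩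
  have hu0 : (u : K) ≠ 0 := Nat.cast_ne_zero.2 (by rintro rfl; simp at hu)
  rw [hk]
  push_cast
  field_simp
  ring

theorem exists_coeff_exp_subst_eq (A : Subring K)
    (hA : ∀ u : ℕ, u.Coprime p → (u : K)⁻¹ ∈ A) {F : K⟦X⟧} (hF0 : constantCoeff F = 0)
    (hF : ∀ n, ∃ c ∈ A, coeff n F = p * c) {n : ℕ} (hn : 0 < n) :
    ∃ c ∈ A, coeff n ((exp K).subst F) = p * c := by
  choose f hfA hf using hF
  have hFG : F = C (p : K) * map A.subtype (mk fun n ↦ ⟨f n, hfA n⟩) := by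
    ext n
    rw [coeff_C_mul, hf]
    simp
  generalize (mk fun n ↦ (⟨f n, hfA n⟩ : A)) = G at hFG
  rw [coeff_subst' (HasSubst.of_constantCoeff_zero' hF0)]
  refine finsum_induction (fun x ↦ ∃ c ∈ A, x = p * c) ⟨0, A.zero_mem, by simp⟩ ?_ ?_
  · rintro _ _ ⟨a, ha, rfl⟩ ⟨b, hb, rfl⟩
    exact ⟨a + b, A.add_mem ha hb, by ring⟩
  · intro d
    rcases eq_or_ne d 0 with rfl | hd
    · exact ⟨0, A.zero_mem, by simp [coeff_one, hn.ne']⟩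
    · obtain ⟨c, hcA, hc⟩ := exists_pow_div_factorial_eq A hA hd
      refine ⟨c * (coeff n (G ^ d) : A), A.mul_mem hcA (Subtype.mem _), ?_⟩
      have hFd : F ^ d = C ((p : K) ^ d) * map A.subtype (G ^ d) := by
        rw [hFG, mul_pow, map_pow, map_pow]
      rw [hFd, coeff_C_mul, coeff_map, coeff_exp, ← mul_assoc, ← hc]
      simp [div_eq_mul_inv]
      ring

end Integrality

/-! ### The series `∫V` and `exp (∫V)` of a `1`-sequence. -/

section LogIntegral

variable {K : Type*} [Field K] [CharZero K]

theorem constantCoeff_logIntegral (V : K⟦X⟧) : constantCoeff (logIntegral V) = 0 := by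
  rw [← coeff_zero_eq_constantCoeff_apply]
  simp [logIntegral]

theorem coeff_derivative_logIntegral (V : K⟦X⟧) (n : ℕ) :
    coeff n (d⁄dX K (logIntegral V)) = coeff (n + 1) V := by
  have : (n : K) + 1 ≠ 0 := Nat.cast_add_one_ne_zero n
  rw [coeff_derivative, logIntegral, coeff_mk]
  push_cast
  field_simp

variable {p : ℕ} [Fact p.Prime]

/-- The congruences defining `1`-sequences say that `∫V^σ(z ^ p) ≡ p ∫V` modulo `p`. -/
theorem exists_coeff_expand_logIntegral_sub_eq (A : Subring K)
    (hA : ∀ u : ℕ, u.Coprime p → (u : K)⁻¹ ∈ A) (σ : K →+* K) {V : K⟦X⟧}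
    (hV : ∀ n, 0 < n → coeff n V ∈ A)
    (hVσ : ∀ m r, 0 < m → 0 < r →
      ∃ c ∈ A, σ (coeff (m * p ^ (r - 1)) V) - coeff (m * p ^ r) V = p ^ r * c) (n : ℕ) :
    ∃ c ∈ A, coeff n (expand p (Fact.out : p.Prime).ne_zero (map σ (logIntegral V)) -
      (p : K⟦X⟧) * logIntegral V) = p * c := by
  have hpp : p.Prime := Fact.out
  have hpK : (p : K) ≠ 0 := Nat.cast_ne_zero.2 hpp.ne_zero
  rcases Nat.eq_zero_or_pos n with rfl | hn
  · exact ⟨0, A.zero_mem, by simp [constantCoeff_logIntegral,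
      constantCoeff_map_eq_zero (constantCoeff_logIntegral V)]⟩
  obtain ⟨r, u, hu, rfl⟩ := Nat.exists_eq_pow_mul_and_not_dvd hn.ne' p hpp.ne_one
  have hu0 : u ≠ 0 := by rintro rfl; simp at hu
  have huK : (u : K) ≠ 0 := Nat.cast_ne_zero.2 hu0
  have huA := hA u ((Nat.Prime.coprime_iff_not_dvd hpp).2 hu).symm
  have hC : (p : K⟦X⟧) = C (p : K) := by simp
  rw [map_sub, coeff_expand, hC, coeff_C_mul]
  cases r with
  | zero =>
    -- For `p ∤ u` the expanded series has no term in degree `u`; only `-p a_u / u` remains.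
    refine ⟨-(coeff u V * (u : K)⁻¹), A.neg_mem (A.mul_mem (hV u (Nat.pos_of_ne_zero hu0)) huA), ?_⟩
    simp [hu, logIntegral, div_eq_mul_inv]
  | succ r =>
    -- The coefficient is `(σ(a_{u p^r}) - a_{u p^(r+1)}) / (u p^r)`; the congruence modulo
    -- `p^(r+1)` leaves one factor `p`.
    obtain ⟨c, hcA, hc⟩ := hVσ u (r + 1) (Nat.pos_of_ne_zero hu0) r.succ_pos
    refine ⟨c * (u : K)⁻¹, A.mul_mem hcA huA, ?_⟩
    have hdiv : p ^ (r + 1) * u / p = u * p ^ r := by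
      rw [pow_succ', mul_assoc, Nat.mul_div_cancel_left _ hpp.pos, mul_comm]
    have hdvd : p ∣ p ^ (r + 1) * u := dvd_mul_of_dvd_left (dvd_pow_self p r.succ_ne_zero) u
    rw [if_pos hdvd, hdiv, coeff_map, mul_comm _ u]
    simp only [logIntegral, coeff_mk, map_div₀, Nat.cast_mul, Nat.cast_pow, map_mul, map_pow, map_natCast]
    rw [Nat.add_sub_cancel, sub_eq_iff_eq_add] at hc
    rw [hc]
    field_simp
    ring

theorem coeff_expLogIntegral_mem (A : Subring K)
    (hA : ∀ u : ℕ, u.Coprime p → (u : K)⁻¹ ∈ A) (hp : (p : K)⁻¹ ∉ A)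
    (σ : K →+* K) (hσ : ∀ x ∈ A, ∃ c ∈ A, σ x - x ^ p = p * c) {V : K⟦X⟧}
    (hV : ∀ n, 0 < n → coeff n V ∈ A)
    (hVσ : ∀ m r, 0 < m → 0 < r →
      ∃ c ∈ A, σ (coeff (m * p ^ (r - 1)) V) - coeff (m * p ^ r) V = p ^ r * c) (n : ℕ) :
    coeff n (expLogIntegral V) ∈ A := by
  have hpp : p.Prime := Fact.out
  have hL := constantCoeff_logIntegral V
  let F := expand p hpp.ne_zero (map σ (logIntegral V)) - (p : K⟦X⟧) * logIntegral V
  have hσL := constantCoeff_map_eq_zero hL σ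
  have hpL : constantCoeff ((p : K⟦X⟧) * logIntegral V) = 0 := by simp [hL]
  have hF0 : constantCoeff F = 0 := by simp [F, hL, hσL]
  refine coeff_mem_of_expand_map_eq A hp (Nat.cast_ne_zero.2 hpp.ne_zero) σ hσ
    (constantCoeff_exp_subst hL) (constantCoeff_exp_subst hF0)
    (fun k hk ↦ exists_coeff_exp_subst_eq A hA hF0
      (exists_coeff_expand_logIntegral_sub_eq A hA σ hV hVσ) hk) ?_ n
  rw [map_exp_subst hL, expand_exp_subst hσL, ← exp_subst_natCast_mul hL,
    ← exp_subst_add hpL hF0]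
  simp [F]

/-- Compare coefficients in `(Y^n)' = n (∫V)' Y^n`, where `(∫V)' = V/z` is integral although `∫V`
need not be. -/
theorem exists_natCast_mul_coeff_expLogIntegral_pow_eq (A : Subring K) {V : K⟦X⟧}
    (hV : ∀ n, 0 < n → coeff n V ∈ A) (hY : ∀ n, coeff n (expLogIntegral V) ∈ A)
    (n : ℕ) {m : ℕ} (hm : 0 < m) :
    ∃ c ∈ A, (m : K) * coeff m (expLogIntegral V ^ n) = n * c := by
  have hL := constantCoeff_logIntegral V
  obtain ⟨m, rfl⟩ := Nat.exists_eq_add_one.2 hm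
  refine ⟨coeff m (d⁄dX K (logIntegral V) * expLogIntegral V ^ n), coeff_mul_mem A
    (fun k ↦ ?_) (coeff_pow_mem A hY n) m, ?_⟩
  · rw [coeff_derivative_logIntegral]
    exact hV _ k.succ_pos
  · have hnL : constantCoeff ((n : K⟦X⟧) * logIntegral V) = 0 := by simp [hL]
    have hD := congrArg (coeff m) (derivative_exp_subst hnL)
    rw [coeff_derivative, exp_subst_natCast_mul hL, Derivation.leibniz,
      Derivation.map_natCast, smul_zero, add_zero, smul_eq_mul, mul_assoc,
      show (n : K⟦X⟧) = C (n : K) by simp, coeff_C_mul] at hD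
    rw [expLogIntegral, ← hD]
    push_cast
    ring

/-- Supercongruence for the coefficients of powers, `p`-locally. -/
theorem exists_coeff_expLogIntegral_pow_eq (A : Subring K)
    (hA : ∀ u : ℕ, u.Coprime p → (u : K)⁻¹ ∈ A) {V : K⟦X⟧}
    (hV : ∀ n, 0 < n → coeff n V ∈ A) (hY : ∀ n, coeff n (expLogIntegral V) ∈ A)
    (n : ℕ) {m : ℕ} (hm : 0 < m) :
    ∃ c ∈ A, coeff m (expLogIntegral V ^ n) =
      (p : K) ^ (padicValNat p n - padicValNat p m) * c := by
  have hpp : p.Prime := Fact.out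
  have hpK : (p : K) ≠ 0 := Nat.cast_ne_zero.2 hpp.ne_zero
  rcases le_or_gt (padicValNat p n) (padicValNat p m) with hle | hlt
  · exact ⟨_, coeff_pow_mem A hY n m, by simp [Nat.sub_eq_zero_of_le hle]⟩
  obtain ⟨c, hcA, hc⟩ := exists_natCast_mul_coeff_expLogIntegral_pow_eq A hV hY n hm
  obtain ⟨e, he⟩ := Nat.exists_eq_add_of_le hlt.le
  obtain ⟨k, u, hu, hk⟩ := Nat.exists_eq_pow_mul_and_not_dvd hm.ne' p hpp.ne_one
  have hu0 : u ≠ 0 := by rintro rfl; simp at hu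
  have hkm : padicValNat p m = k := by
    rw [hk, padicValNat.mul (pow_ne_zero _ hpp.ne_zero) hu0,
      padicValNat.prime_pow, padicValNat.eq_zero_of_not_dvd hu, add_zero]
  obtain ⟨w, hw⟩ := pow_padicValNat_dvd (p := p) (n := n)
  have huK : (u : K) ≠ 0 := Nat.cast_ne_zero.2 hu0
  refine ⟨w * (u : K)⁻¹ * c, A.mul_mem (A.mul_mem (natCast_mem A w)
    (hA u ((Nat.Prime.coprime_iff_not_dvd hpp).2 hu).symm)) hcA, ?_⟩
  rw [he, Nat.add_sub_cancel_left]
  -- With `n = p^(k+e) w` and `m = p^k u`, cancelling `p^k` and inverting `u` leaves `p^e`.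
  have hnK : (n : K) = p ^ k * p ^ e * w := by
    rw [he, hkm] at hw
    exact_mod_cast hw.trans (by rw [pow_add])
  have hmK : (m : K) = p ^ k * u := by exact_mod_cast hk
  have hpk : (p : K) ^ k ≠ 0 := pow_ne_zero _ hpK
  rw [hnK, hmK] at hc
  field_simp
  refine mul_left_cancel₀ hpk ?_
  linear_combination hc

end LogIntegral

end PowerSeries

/-! ### The valuation ring of `v` in `K` and its Frobenius. -/

section LocalFacts

open IsDedekindDomain

theorem liesOver_span_of_natCast_mem {K : Type*} [Field K]
    {p : ℕ} {v : HeightOneSpectrum (𝓞 K)} (hp : p.Prime) (hv : (p : 𝓞 K) ∈ v.asIdeal) :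
    v.asIdeal.LiesOver (Ideal.span {(p : ℤ)}) := by
  refine ⟨?_⟩
  have hmax : (Ideal.span {(p : ℤ)}).IsMaximal :=
    PrincipalIdealRing.isMaximal_of_irreducible (Nat.prime_iff_prime_int.1 hp).irreducible
  refine hmax.eq_of_le (Ideal.IsPrime.ne_top inferInstance) ?_
  rw [Ideal.span_singleton_le_iff_mem, Ideal.mem_comap]
  simpa using hv

variable {K : Type*} [Field K] [NumberField K] {p : ℕ} {v : HeightOneSpectrum (𝓞 K)}

/-- Ramification index `1` means `p ∉ 𝔭^2`, so `p` is a uniformizer at `v`; hence congruences modulo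
`𝔭` become divisibility by `p`. -/
theorem valuation_natCast_of_isUnramifiedPrime (hp : IsUnramifiedPrime K p)
    (hv : (p : 𝓞 K) ∈ v.asIdeal) : v.valuation K (p : K) = WithZero.exp (-1 : ℤ) := by
  have hlo := liesOver_span_of_natCast_mem hp.1 hv
  have hp0 : (Ideal.span {(p : ℤ)}) ≠ ⊥ := by simpa using hp.1.ne_zero
  have he : (Ideal.span {(p : ℤ)}).ramificationIdx' v.asIdeal = 1 := by
    rw [Ideal.ramificationIdx'_eq_ramificationIdx _ _ hp0]
    exact hp.2.ramificationIdx_eq_one hlo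
  have hmap : (Ideal.span {(p : ℤ)}).map (algebraMap ℤ (𝓞 K)) = Ideal.span {(p : 𝓞 K)} := by
    rw [Ideal.map_span]
    simp
  have hsq : (p : 𝓞 K) ∉ v.asIdeal ^ 2 := by
    intro h
    refine (Ideal.ramificationIdx'_ne_one_iff ?_).2 ?_ he
    · rwa [hmap, Ideal.span_singleton_le_iff_mem]
    · rwa [hmap, Ideal.span_singleton_le_iff_mem]
  have hpR : ((p : 𝓞 K)) ≠ 0 := Nat.cast_ne_zero.2 hp.1.ne_zero
  have hval : v.valuation K (p : K) = v.intValuation (p : 𝓞 K) := by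
    rw [← v.valuation_of_algebraMap (K := K)]
    simp
  rw [hval]
  refine le_antisymm ?_ ?_
  · simpa using (v.intValuation_le_pow_iff_mem (p : 𝓞 K) 1).2 (by simpa using hv)
  · rw [← v.intValuation_le_pow_iff_mem, v.intValuation_if_neg hpR, WithZero.exp_le_exp] at hsq
    rw [v.intValuation_if_neg hpR, WithZero.exp_le_exp]
    push_cast at hsq
    lia

theorem exists_eq_natCast_mul_of_valuation_lt_one (hp : IsUnramifiedPrime K p)
    (hv : (p : 𝓞 K) ∈ v.asIdeal) {x : K} (hx : v.valuation K x < 1) :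
    ∃ c ∈ (v.valuation K).integer, x = p * c := by
  have hpK : (p : K) ≠ 0 := Nat.cast_ne_zero.2 hp.1.ne_zero
  refine ⟨x / p, ?_, by field_simp⟩
  rw [Valuation.mem_integer_iff, map_div₀, valuation_natCast_of_isUnramifiedPrime hp hv]
  refine div_le_one_of_le₀ ?_ zero_le
  rcases eq_or_ne (v.valuation K x) 0 with h0 | h0
  · simp [h0]
  · rw [← WithZero.exp_log h0, WithZero.exp_le_exp]
    rw [← WithZero.exp_log h0, ← WithZero.exp_zero, WithZero.exp_lt_exp] at hx
    lia

theorem inv_natCast_mem_integer_of_coprime (hv : (p : 𝓞 K) ∈ v.asIdeal) {u : ℕ}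
    (hu : u.Coprime p) : (u : K)⁻¹ ∈ (v.valuation K).integer := by
  have huv : (u : 𝓞 K) ∉ v.asIdeal := by
    intro h
    obtain ⟨a, b, hab⟩ := Nat.isCoprime_iff_coprime.2 hu
    refine v.isPrime.ne_top ((Ideal.eq_top_iff_one _).2 ?_)
    have : (a : 𝓞 K) * u + b * p = 1 := by exact_mod_cast congrArg (Int.cast : ℤ → 𝓞 K) hab
    rw [← this]
    exact add_mem (Ideal.mul_mem_left _ _ h) (Ideal.mul_mem_left _ _ hv)
  have := (v.valuation_eq_one_iff_notMem (K := K)).2 huv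
  rw [map_natCast] at this
  simp [Valuation.mem_integer_iff, this]

theorem inv_natCast_notMem_integer (hp : p.Prime) (hv : (p : 𝓞 K) ∈ v.asIdeal) :
    (p : K)⁻¹ ∉ (v.valuation K).integer := by
  have h1 : v.valuation K (p : K) < 1 := by
    rw [← map_natCast (algebraMap (𝓞 K) K)]
    exact (v.valuation_lt_one_iff_mem _).2 hv
  have h0 : v.valuation K (p : K) ≠ 0 :=
    (Valuation.ne_zero_iff _).2 (Nat.cast_ne_zero.2 hp.ne_zero)
  rw [Valuation.mem_integer_iff, map_inv₀, not_le]
  exact (one_lt_inv₀ (zero_lt_iff.2 h0)).2 h1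

theorem algebraMap_mem_adicCompletionIntegers_iff (c : K) :
    algebraMap K (v.adicCompletion K) c ∈ v.adicCompletionIntegers K ↔
      c ∈ (v.valuation K).integer := by
  rw [HeightOneSpectrum.mem_adicCompletionIntegers, Valuation.mem_integer_iff,
    ← HeightOneSpectrum.valuedAdicCompletion_eq_valuation' v c]
  rfl

/-- The quotient `(x - y) / p^k` already lies in `K`, so its integrality can be tested there without
the completion. -/
theorem congrModPow_iff (hp : p ≠ 0) {k : ℕ} {x y : K} :
    CongrModPow K v p k x y ↔ ∃ c ∈ (v.valuation K).integer, x - y = p ^ k * c := by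
  have hpK : (p : K) ≠ 0 := Nat.cast_ne_zero.2 hp
  constructor
  · rintro ⟨c, hc, h⟩
    refine ⟨(x - y) / p ^ k, (algebraMap_mem_adicCompletionIntegers_iff _).1 ?_, by field_simp⟩
    have hpv : (p : v.adicCompletion K) ≠ 0 := by
      rw [← map_natCast (algebraMap K (v.adicCompletion K))]
      exact (map_ne_zero _).2 hpK
    rw [map_div₀, h, map_pow, map_natCast, mul_div_cancel_left₀ _ (pow_ne_zero _ hpv)]
    exact hc
  · rintro ⟨c, hc, h⟩
    exact ⟨_, (algebraMap_mem_adicCompletionIntegers_iff c).2 hc, by rw [h, map_mul, map_pow, map_natCast]⟩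

variable [IsGalois ℚ K]

theorem exists_frobeniusAt_algebraMap_eq (hp : p.Prime) (hv : (p : 𝓞 K) ∈ v.asIdeal) (x : 𝓞 K) :
    ∃ y : 𝓞 K, frobeniusAt K v (algebraMap (𝓞 K) K x) = algebraMap (𝓞 K) K y ∧
      y - x ^ p ∈ v.asIdeal := by
  have : Finite (𝓞 K ⧸ v.asIdeal) := Ideal.finiteQuotientOfFreeOfNeBot v.asIdeal v.ne_bot
  have h := IsArithFrobAt.arithFrobAt ℤ (K ≃ₐ[ℚ] K) v.asIdeal x
  have hlo := liesOver_span_of_natCast_mem hp hv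
  -- The exponent in the arithmetic Frobenius is the size of the residue ring `ℤ/p` below, namely
  -- `p`.
  rw [← hlo.over, Nat.card_congr (Int.quotientSpanNatEquivZMod p).toEquiv, Nat.card_zmod] at h
  refine ⟨_, ?_, by simpa using h⟩
  rfl

/-- Extends the Frobenius congruence from `𝓞 K` to its localization: write `x = a/b` with `b ∉ 𝔭`;
then `σ(b) ≡ b^p` is also outside `𝔭`, and clearing denominators reduces to `a` and `b`. -/
theorem exists_frobeniusAt_sub_pow_eq (hp : IsUnramifiedPrime K p)
    (hv : (p : 𝓞 K) ∈ v.asIdeal) {x : K} (hx : x ∈ (v.valuation K).integer) :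
    ∃ c ∈ (v.valuation K).integer, frobeniusAt K v x - x ^ p = p * c := by
  refine exists_eq_natCast_mul_of_valuation_lt_one hp hv ?_
  obtain ⟨a, ⟨b, hb⟩, hab⟩ := v.exists_primeCompl_mul_eq_of_integer x hx
  obtain ⟨a', ha', haa'⟩ := exists_frobeniusAt_algebraMap_eq hp.1 hv a
  obtain ⟨b', hb', hbb'⟩ := exists_frobeniusAt_algebraMap_eq hp.1 hv b
  have hbK : v.valuation K (algebraMap (𝓞 K) K b) = 1 := v.valuation_eq_one_iff_notMem.2 hb
  have hb'v : b' ∉ v.asIdeal := fun h ↦ hb (v.isPrime.mem_of_pow_mem p (by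
    simpa using sub_mem h hbb'))
  have hb'K : v.valuation K (algebraMap (𝓞 K) K b') = 1 := v.valuation_eq_one_iff_notMem.2 hb'v
  have hnum : a' * b ^ p - a ^ p * b' ∈ v.asIdeal := by
    have : a' * b ^ p - a ^ p * b' = b ^ p * (a' - a ^ p) - a ^ p * (b' - b ^ p) := by ring
    rw [this]
    exact sub_mem (Ideal.mul_mem_left _ _ haa') (Ideal.mul_mem_left _ _ hbb')
  have hnumK : v.valuation K (algebraMap (𝓞 K) K (a' * b ^ p - a ^ p * b')) < 1 :=
    (v.valuation_lt_one_iff_mem _).2 hnum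
  have hσ := congrArg (frobeniusAt K v) hab
  dsimp only at hab hσ
  rw [map_mul, ha', hb'] at hσ
  have heq : (frobeniusAt K v x - x ^ p) * (algebraMap (𝓞 K) K b' * algebraMap (𝓞 K) K b ^ p) =
      algebraMap (𝓞 K) K (a' * b ^ p - a ^ p * b') := by
    rw [map_sub, map_mul, map_mul, map_pow, map_pow, ← hσ, ← hab]
    ring
  rw [← heq, map_mul, map_mul, map_pow, hbK, hb'K, one_pow, mul_one, mul_one] at hnumK
  exact hnumK

end LocalFacts

theorem mainTheorem4 (K : Type*) [Field K] [NumberField K] [IsGalois ℚ K]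
    (V Y : K⟦X⟧) (hV : V ∈ SSeries K 1) (hY : Y = expLogIntegral V)
    (p : ℕ) (hp : IsUnramifiedPrime K p)
    (v : IsDedekindDomain.HeightOneSpectrum (𝓞 K)) (hv : (p : 𝓞 K) ∈ v.asIdeal)
    (n m : ℕ) (hn : 0 < n) (hm : 0 < m) :
    CongrModPow K v p (max 0 ((padicValNat p n : ℤ) - (padicValNat p m : ℤ))).toNat
      (PowerSeries.coeff m (Y ^ n)) 0 := by
  have : Fact p.Prime := ⟨hp.1⟩
  subst hY
  obtain ⟨hint, hcongr⟩ := hV.2 p hp v hv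
  have hint' : ∀ k, 0 < k → PowerSeries.coeff k V ∈ (v.valuation K).integer := fun k hk ↦
    (algebraMap_mem_adicCompletionIntegers_iff _).1 (hint k hk)
  have hA : ∀ u : ℕ, u.Coprime p → (u : K)⁻¹ ∈ (v.valuation K).integer := fun u hu ↦
    inv_natCast_mem_integer_of_coprime hv hu
  have hYint := PowerSeries.coeff_expLogIntegral_mem (p := p) _ hA
    (inv_natCast_notMem_integer hp.1 hv) (frobeniusAt K v : K →+* K)
    (fun x hx ↦ exists_frobeniusAt_sub_pow_eq hp hv hx) hint' (fun i r hi hr ↦ by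
      have := (congrModPow_iff hp.1.ne_zero).1 (hcongr i r hi hr)
      rw [one_mul] at this
      exact this)
  have hexp : (max 0 ((padicValNat p n : ℤ) - (padicValNat p m : ℤ))).toNat =
      padicValNat p n - padicValNat p m := by lia
  rw [congrModPow_iff hp.1.ne_zero, hexp, sub_zero]
  exact PowerSeries.exists_coeff_expLogIntegral_pow_eq _ hA hint' hYint n hm
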